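/- **Adiabatic theorem.** Let $\mathcal H$ be a complex Hilbert space and $T\ge 0$. For $t\in[0,T]$ let $H_0(t)$ be a bounded self-adjoint operator on $\mathcal H$ with the finite spectral representation $$H_0(t)=\sum_{\ell=1}^m E_\ell(t)P_\ell(t),$$ where $E_\ell(t)\in\mathbb R$, $P_\ell(t)=P_\ell(t)^\dagger$, $P_k(t)P_\ell(t)=\delta_{k\ell}P_\ell(t)$ for all $k,\ell$, and $\sum_{\ell=1}^m P_\ell(t)=1$. Assume that every $E_\ell$ is $C^1$ and every $P_\ell$ is $C^2$ (in operator norm) on $[0,T]$, and that there are no level crossings: $|E_k(t)-E_\ell(t)|>0$ for all $t\in[0,T]$ and $k\neq\ell$. Put $$A(t)=\sum_{\ell=1}^m\frac{\mathrm i}{2}[\dot P_\ell(t),P_\ell(t)],\qquad \eta=\min_{k\neq\ell}\min_{t\in[0,T]}|E_k(t)-E_\ell(t)|,\qquad \eta'=\max_{k\neq\ell}\max_{t\in[0,T]}|\dot E_k(t)-\dot E_\ell(t)|,$$ and $\|B\|_{\infty,T}=\sup_{s\in[0,T]}\|B(s)\|$, with $\|\cdot\|$ the operator norm. For a norm-continuous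 family $H(t)$ of bounded operators let $$\mathcal T\exp\Bigl(-\mathrm i\int_0^t H(s)\,ds\Bigr)=\sum_{n\ge0}(-\mathrm i)^n\int_{t\ge s_1\ge\dots\ge s_n\ge0}H(s_1)\cdots H(s_n)\,ds_1\cdots ds_n$$ be the propagator it generates. Then, for all $\kappa>0$ and all $t\in[0,T]$, $$\left\|\mathcal T\exp\Bigl(-\mathrm i\int_0^t\kappa H_0(s)\,ds\Bigr)-\mathcal T\exp\Bigl(-\mathrm i\int_0^t[\kappa H_0(s)+A(s)]\,ds\Bigr)\right\|\le\frac{\sqrt m}{\kappa\eta}\,(1+T\|A\|_{\infty,T})\left[\Bigl(2+\frac{\eta'}{\eta}T\Bigr)\|A\|_{\infty,T}+T\|\dot A\|_{\infty,T}\right].$$ (If $m\le 1$ there is no gap, $A=0$, and the right-hand side is read as $0$.) -/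

import Mathlib

open Set

noncomputable section

namespace Adiabatic

variable {𝓗 : Type*} [NormedAddCommGroup 𝓗] [InnerProductSpace ℂ 𝓗] [CompleteSpace 𝓗]

/-- The `n`-th term of the Dyson series of the time-dependent Hamiltonian `H`, i.e.
`(-i)^n ∫_{t ≥ s₁ ≥ ⋯ ≥ sₙ ≥ 0} H(s₁) ⋯ H(sₙ)`, written as an iterated integral. -/
def dysonTerm (H : ℝ → 𝓗 →L[ℂ] 𝓗) : ℕ → ℝ → 𝓗 →L[ℂ] 𝓗
  | 0 => fun _ => 1
  | n + 1 => fun t => (-Complex.I) • ∫ s in (0 : ℝ)..t, H s * dysonTerm H n s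

/-- The propagator `𝒯 exp(-i ∫₀ᵗ H(s) ds)` generated by `H`, as the sum of the Dyson series
(which converges in operator norm when `H` is integrable on `[0, t]`). -/
def propagator (H : ℝ → 𝓗 →L[ℂ] 𝓗) (t : ℝ) : 𝓗 →L[ℂ] 𝓗 :=
  ∑' n, dysonTerm H n t

/-- `‖A‖_{∞,T} = sup_{s ∈ [0,T]} ‖A(s)‖`. -/
def supNorm (T : ℝ) (A : ℝ → 𝓗 →L[ℂ] 𝓗) : ℝ :=
  sSup ((fun s => ‖A s‖) '' Icc 0 T)

/-- The generator `A(t) = ∑ₗ (i/2) [Ṗₗ(t), Pₗ(t)]` of the adiabatic transporter; the time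
derivatives are taken within `[0, T]` (one-sided at the end points). -/
def connection {m : ℕ} (T : ℝ) (P : Fin m → ℝ → 𝓗 →L[ℂ] 𝓗) (t : ℝ) : 𝓗 →L[ℂ] 𝓗 :=
  ∑ l, (Complex.I / 2) •
    (derivWithin (P l) (Icc 0 T) t * P l t - P l t * derivWithin (P l) (Icc 0 T) t)

/-- The minimal spectral gap `η = min_{k ≠ l} min_{t ∈ [0,T]} |Eₖ(t) - Eₗ(t)|`. -/
def minGap {m : ℕ} (T : ℝ) (E : Fin m → ℝ → ℝ) : ℝ :=
  sInf {x | ∃ k l : Fin m, k ≠ l ∧ ∃ t ∈ Icc 0 T, x = |E k t - E l t|}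

/-- The maximal spectral slope `η' = max_{k ≠ l} max_{t ∈ [0,T]} |d/dt (Eₖ(t) - Eₗ(t))|`. -/
def maxSlope {m : ℕ} (T : ℝ) (E : Fin m → ℝ → ℝ) : ℝ :=
  sSup {x | ∃ k l : Fin m, k ≠ l ∧ ∃ t ∈ Icc 0 T,
    x = |derivWithin (fun s => E k s - E l s) (Icc 0 T) t|}

end Adiabatic

end

/-!
Let `F` be the solution of `[H₀, F] = A` obtained by dividing the off-diagonal blocks `Pₖ A Pₗ` of
`A` by the gaps `Eₖ - Eₗ`; it exists because the diagonal blocks of `A` vanish. Then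
`(κ H₀ + A)(1 - κ⁻¹ F) - (1 - κ⁻¹ F) κ H₀ = -κ⁻¹ A F`, so `1 - κ⁻¹ F` intertwines the two
propagators up to the integrated error `κ⁻¹ ∫ ‖F' + i A F‖`, and the propagators themselves differ
by at most `κ⁻¹ (‖F(0)‖ + ‖F(t)‖)` more.

The projections are parallel for the connection, `Pₗ' = -i [A, Pₗ]`, so differentiating the blocks
of `F` only produces derivatives of the inverse gaps and of `A`, besides a commutator with `A` that
combines with `i A F` to `i F A`. The factor `√m` comes from the C⋆-identity applied to a sum of `m`
mutually orthogonal columns.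
-/

namespace Adiabatic

section OrthogonalIdempotents

variable {R ι : Type*} [Ring R] [Fintype ι] {p d : ι → R}

theorem sum_mul_mul_of_orthogonalIdempotents (hp : OrthogonalIdempotents p) (d : ι → R) (l : ι) :
    (∑ k, d k * p k) * p l = d l * p l := by
  classical
  simp [Finset.sum_mul, mul_assoc, hp.mul_eq]

variable [DecidableEq ι]

theorem mul_sum_mul_of_leibniz (hp : CompleteOrthogonalIdempotents p)
    (hd : ∀ k l, d k * p l + p k * d l = if k = l then d l else 0) (l : ι) :
    p l * ∑ k, d k * p k = d l * p l - d l := by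
  have hterm (k : ι) : p l * (d k * p k) = (if l = k then d k * p k else 0) - d l * p k := by
    rw [← mul_assoc, eq_sub_of_add_eq' (hd l k), sub_mul, mul_assoc, (hp.idem k).eq, ite_mul,
      zero_mul]
  rw [Finset.mul_sum, Finset.sum_congr rfl fun k _ => hterm k, Finset.sum_sub_distrib,
    ← Finset.mul_sum, hp.complete, mul_one, Finset.sum_ite_eq, if_pos (Finset.mem_univ l)]

theorem lie_sum_mul_of_leibniz (hp : CompleteOrthogonalIdempotents p)
    (hd : ∀ k l, d k * p l + p k * d l = if k = l then d l else 0) (l : ι) :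
    ⁅∑ k, d k * p k, p l⁆ = d l := by
  rw [Ring.lie_def, sum_mul_mul_of_orthogonalIdempotents hp.toOrthogonalIdempotents,
    mul_sum_mul_of_leibniz hp hd, sub_sub_cancel]

theorem mul_sum_mul_mul_self_of_leibniz (hp : CompleteOrthogonalIdempotents p)
    (hd : ∀ k l, d k * p l + p k * d l = if k = l then d l else 0) (l : ι) :
    p l * (∑ k, d k * p k) * p l = 0 := by
  rw [mul_sum_mul_of_leibniz hp hd, sub_mul, mul_assoc, (hp.idem l).eq, sub_self]

theorem sum_eq_zero_of_leibniz (hp : ∑ l, p l = 1)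
    (hd : ∀ k l, d k * p l + p k * d l = if k = l then d l else 0) : ∑ k, d k = 0 := by
  have hmul (l : ι) : (∑ k, d k) * p l = 0 := by
    have h := Finset.sum_congr rfl fun k (_ : k ∈ Finset.univ) => hd k l
    simpa [Finset.sum_add_distrib, ← Finset.sum_mul, hp] using h
  rw [← mul_one (∑ k, d k), ← hp, Finset.mul_sum, Finset.sum_eq_zero fun l _ => hmul l]

theorem sum_commutator_of_leibniz (hp : CompleteOrthogonalIdempotents p)
    (hd : ∀ k l, d k * p l + p k * d l = if k = l then d l else 0) :
    ∑ l, (d l * p l - p l * d l) = 2 * ∑ l, d l * p l := by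
  have hterm (l : ι) : d l * p l - p l * d l = 2 * (d l * p l) - d l := by
    rw [eq_sub_of_add_eq' ((hd l l).trans (if_pos rfl))]
    noncomm_ring
  rw [Finset.sum_congr rfl fun l _ => hterm l, Finset.sum_sub_distrib,
    sum_eq_zero_of_leibniz hp.complete hd, sub_zero, Finset.mul_sum]

end OrthogonalIdempotents

section SchurMul

variable {𝕜 R ι : Type*} [Ring R] [Fintype ι]

/-- The Schur (entrywise) product of the scalar matrix `c` with `a`, viewed as the matrix of blocks
`p k * a * p l` with respect to the idempotents `p`. With the inverse gaps `(e k - e l)⁻¹` as `c` it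
inverts the commutator with `∑ j, e j • p j` off the diagonal. -/
def schurMul [CommSemiring 𝕜] [Algebra 𝕜 R] (c : ι → ι → 𝕜) (p : ι → R) (a : R) : R :=
  ∑ k, ∑ l, c k l • (p k * a * p l)

theorem schurMul_const [CommSemiring 𝕜] [Algebra 𝕜 R] {p : ι → R} (hp : ∑ l, p l = 1) (c : 𝕜)
    (a : R) : schurMul (fun _ _ => c) p a = c • a := by
  simp only [schurMul, ← Finset.smul_sum, ← Finset.mul_sum, ← Finset.sum_mul, hp, one_mul, mul_one]

theorem lie_schurMul [CommRing 𝕜] [Algebra 𝕜 R] {p : ι → R} (hp : OrthogonalIdempotents p)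
    (e : ι → 𝕜) (c : ι → ι → 𝕜) (a : R) :
    ⁅∑ j, e j • p j, schurMul c p a⁆ = schurMul (fun k l => (e k - e l) * c k l) p a := by
  classical
  have hleft (k : ι) : (∑ j, e j • p j) * p k = e k • p k := by
    simp [Finset.sum_mul, hp.mul_eq]
  have hright (l : ι) : p l * ∑ j, e j • p j = e l • p l := by
    simp [Finset.mul_sum, hp.mul_eq]
  simp only [Ring.lie_def, schurMul, Finset.mul_sum _ _ (∑ j, e j • p j),
    Finset.sum_mul _ _ (∑ j, e j • p j), ← Finset.sum_sub_distrib]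
  refine Finset.sum_congr rfl fun k _ => Finset.sum_congr rfl fun l _ => ?_
  rw [mul_smul_comm, smul_mul_assoc, mul_assoc _ (p l), hright, ← mul_assoc, ← mul_assoc, hleft]
  simp only [smul_mul_assoc, mul_smul_comm]
  module

theorem lie_schurMul_inv_sub [Field 𝕜] [Algebra 𝕜 R] {p : ι → R}
    (hp : CompleteOrthogonalIdempotents p) {e : ι → 𝕜} (he : Function.Injective e) {a : R}
    (ha : ∀ l, p l * a * p l = 0) :
    ⁅∑ j, e j • p j, schurMul (fun k l => (e k - e l)⁻¹) p a⁆ = a := by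
  rw [lie_schurMul hp.toOrthogonalIdempotents]
  trans schurMul (fun _ _ => (1 : 𝕜)) p a
  · refine Finset.sum_congr rfl fun k _ => Finset.sum_congr rfl fun l _ => ?_
    rcases eq_or_ne k l with rfl | hkl
    · simp [ha]
    · simp only [mul_inv_cancel₀ (sub_ne_zero.2 (he.ne hkl))]
  · rw [schurMul_const hp.complete, one_smul]

end SchurMul

section CStarAlgebra

variable {𝔸 ι : Type*} [CStarAlgebra 𝔸] [Fintype ι] {p : ι → 𝔸}

theorem norm_sum_mul_le (hp : OrthogonalIdempotents p) (hadj : ∀ l, IsSelfAdjoint (p l))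
    {x : ι → 𝔸} {r : ℝ} (hr : 0 ≤ r) (hx : ∀ l, ‖x l‖ ≤ r) :
    ‖∑ l, x l * p l‖ ≤ √(Fintype.card ι) * r := by
  classical
  have hself : (∑ l, x l * p l) * star (∑ l, x l * p l) = ∑ l, x l * p l * star (x l) := by
    have hterm (k l : ι) :
        x k * p k * (p l * star (x l)) = if k = l then x k * p k * star (x k) else 0 := by
      rw [mul_assoc, ← mul_assoc (p k), hp.mul_eq]
      split_ifs with hkl
      · rw [hkl, mul_assoc]
      · simp
    simp only [star_sum, star_mul, (hadj _).star_eq, Finset.sum_mul_sum, hterm, Finset.sum_ite_eq,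
      Finset.mem_univ, if_true]
  have hterm_le (l : ι) : ‖x l * p l * star (x l)‖ ≤ r ^ 2 := by
    have hpl : ‖p l‖ ≤ 1 := IsStarProjection.norm_le (p l) ⟨hp.idem l, hadj l⟩
    calc ‖x l * p l * star (x l)‖ ≤ ‖x l‖ * ‖p l‖ * ‖star (x l)‖ := norm_mul₃_le
      _ ≤ r * 1 * r := by rw [norm_star]; gcongr <;> exact hx l
      _ = r ^ 2 := by ring
  refine (pow_le_pow_iff_left₀ (norm_nonneg _) (by positivity) two_ne_zero).1 ?_
  calc ‖∑ l, x l * p l‖ ^ 2 = ‖∑ l, x l * p l * star (x l)‖ := by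
        rw [sq, ← CStarRing.norm_self_mul_star, hself]
    _ ≤ ∑ _l : ι, r ^ 2 := norm_sum_le_of_le _ fun l _ => hterm_le l
    _ = (√(Fintype.card ι) * r) ^ 2 := by
        rw [mul_pow, Real.sq_sqrt (Nat.cast_nonneg _), Finset.sum_const, nsmul_eq_mul,
          Finset.card_univ]

variable [PartialOrder 𝔸] [StarOrderedRing 𝔸]

theorem norm_sum_smul_le (hp : CompleteOrthogonalIdempotents p)
    (hadj : ∀ l, IsSelfAdjoint (p l)) {c : ι → ℝ} {r : ℝ} (hr : 0 ≤ r) (hc : ∀ l, |c l| ≤ r) :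
    ‖∑ l, c l • p l‖ ≤ r := by
  classical
  have hself : star (∑ l, c l • p l) * ∑ l, c l • p l = ∑ l, c l ^ 2 • p l := by
    simp [(hadj _).star_eq, Finset.sum_mul_sum, hp.mul_eq, smul_smul, sq]
  have hle : ∑ l, c l ^ 2 • p l ≤ algebraMap ℝ 𝔸 (r ^ 2) := by
    rw [Algebra.algebraMap_eq_smul_one, ← hp.complete, Finset.smul_sum]
    refine Finset.sum_le_sum fun l _ => smul_le_smul_of_nonneg_right ?_
      (IsStarProjection.nonneg ⟨hp.idem l, hadj l⟩)
    exact sq_le_sq' (neg_le_of_abs_le (hc l)) (le_of_abs_le (hc l))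
  refine (pow_le_pow_iff_left₀ (norm_nonneg _) hr two_ne_zero).1 ?_
  rw [sq, ← CStarRing.norm_star_mul_self, CStarAlgebra.norm_le_iff_le_algebraMap _ (sq_nonneg r)
    (star_mul_self_nonneg _), hself]
  exact hle

/-- The factor `√(card ι)` is the price of summing the mutually orthogonal columns; within a column,
`∑ k, c k l • p k` is normal of norm at most `r`. -/
theorem norm_schurMul_le (hp : CompleteOrthogonalIdempotents p)
    (hadj : ∀ l, IsSelfAdjoint (p l)) {c : ι → ι → ℝ} {r : ℝ} (hr : 0 ≤ r)
    (hc : ∀ k l, |c k l| ≤ r) (a : 𝔸) :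
    ‖schurMul c p a‖ ≤ √(Fintype.card ι) * r * ‖a‖ := by
  have hrows : schurMul c p a = ∑ l, (∑ k, c k l • p k) * a * p l := by
    simp only [schurMul, Finset.sum_mul, smul_mul_assoc]
    exact Finset.sum_comm
  rw [hrows, mul_assoc]
  refine norm_sum_mul_le hp.toOrthogonalIdempotents hadj (by positivity) fun l => ?_
  exact norm_mul_le_of_le (norm_sum_smul_le hp hadj hr fun k => hc k l) le_rfl

/-- For a parallel family `p` and `F = schurMul w p x`, the left-hand side is the norm of
`F' + i x F`, with `F'` as in `hasDerivWithinAt_schurMul_of_parallel` below. -/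
theorem norm_schurMul_deriv_add_le {x x' : 𝔸} {w w' : ι → ι → ℝ} {g g' a b : ℝ}
    (hp : CompleteOrthogonalIdempotents p) (hadj : ∀ l, IsSelfAdjoint (p l))
    (hg : 0 ≤ g) (hg' : 0 ≤ g')
    (hw : ∀ k l, |w k l| ≤ g) (hw' : ∀ k l, |w' k l| ≤ g') (hx : ‖x‖ ≤ a) (hx' : ‖x'‖ ≤ b) :
    ‖schurMul w' p x + schurMul w p (x' - ⁅(-Complex.I) • x, x⁆) +
      ⁅(-Complex.I) • x, schurMul w p x⁆ + Complex.I • (x * schurMul w p x)‖ ≤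
      √(Fintype.card ι) * (g' * a + g * (b + a ^ 2)) := by
  have hmerge : schurMul w' p x + schurMul w p (x' - ⁅(-Complex.I) • x, x⁆) +
      ⁅(-Complex.I) • x, schurMul w p x⁆ + Complex.I • (x * schurMul w p x) =
      schurMul w' p x + schurMul w p x' + Complex.I • (schurMul w p x * x) := by
    simp only [Ring.lie_def, smul_mul_assoc, mul_smul_comm, sub_self, sub_zero]
    module
  have hschur : ‖schurMul w p x‖ ≤ √(Fintype.card ι) * g * a :=
    (norm_schurMul_le hp hadj hg hw x).trans (by gcongr)
  rw [hmerge]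
  calc ‖schurMul w' p x + schurMul w p x' + Complex.I • (schurMul w p x * x)‖
      ≤ √(Fintype.card ι) * g' * a + √(Fintype.card ι) * g * b +
          √(Fintype.card ι) * g * a * a := by
        refine norm_add_le_of_le (norm_add_le_of_le ?_ ?_) ?_
        · exact (norm_schurMul_le hp hadj hg' hw' x).trans (by gcongr)
        · exact (norm_schurMul_le hp hadj hg hw x').trans (by gcongr)
        · rw [norm_smul, Complex.norm_I, one_mul]
          exact norm_mul_le_of_le hschur hx
    _ = √(Fintype.card ι) * (g' * a + g * (b + a ^ 2)) := by ring

end CStarAlgebra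

section Calculus

theorem hasDerivWithinAt_integral_Icc {F : Type*} [NormedAddCommGroup F] [NormedSpace ℝ F]
    [CompleteSpace F] {a b t : ℝ} {f : ℝ → F} (hf : ContinuousOn f (Icc a b))
    (ht : t ∈ Icc a b) :
    HasDerivWithinAt (fun u => ∫ s in a..u, f s) (f t) (Icc a b) t := by
  have : Fact (t ∈ Icc a b) := ⟨ht⟩
  have hint : IntervalIntegrable f MeasureTheory.volume a t :=
    (hf.mono (Icc_subset_Icc_right ht.2)).intervalIntegrable_of_Icc ht.1
  exact intervalIntegral.integral_hasDerivWithinAt_right (t := Icc a b) hint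
    (hf.stronglyMeasurableAtFilter_nhdsWithin measurableSet_Icc t) (hf t ht)

theorem eq_zero_of_hasDerivWithinAt_lie {𝔸 : Type*} [NormedRing 𝔸] [NormedSpace ℝ 𝔸]
    {K X : ℝ → 𝔸} {a b : ℝ} (hK : ContinuousOn K (Icc a b))
    (hX : ∀ t ∈ Icc a b, HasDerivWithinAt X ⁅K t, X t⁆ (Icc a b) t) (ha : X a = 0) :
    ∀ t ∈ Icc a b, X t = 0 := by
  obtain ⟨M, hM⟩ := isCompact_Icc.exists_bound_of_continuousOn hK
  refine eq_zero_of_abs_deriv_le_mul_abs_self_of_eq_zero_right (K := 2 * M)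
    (fun t ht => (hX t ht).continuousWithinAt)
    (fun t ht => (hX t (Ico_subset_Icc_self ht)).mono_of_mem_nhdsWithin
      (Icc_mem_nhdsGE_of_mem ht)) ha fun t ht => ?_
  have hMt := hM t (Ico_subset_Icc_self ht)
  calc ‖⁅K t, X t⁆‖ ≤ ‖K t‖ * ‖X t‖ + ‖X t‖ * ‖K t‖ :=
        norm_sub_le_of_le (norm_mul_le _ _) (norm_mul_le _ _)
    _ ≤ M * ‖X t‖ + ‖X t‖ * M := by gcongr
    _ = 2 * M * ‖X t‖ := by ring

end Calculus

section ParallelTransport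

variable {𝕜 𝔸 ι : Type*} [NontriviallyNormedField 𝕜] [NormedRing 𝔸] [NormedAlgebra 𝕜 𝔸]
  {S : Set 𝕜} {t : 𝕜} {P : ι → 𝕜 → 𝔸}

theorem derivWithin_leibniz_of_orthogonalIdempotents [DecidableEq ι]
    (ht : t ∈ S) (hP : ∀ s ∈ S, OrthogonalIdempotents fun l => P l s)
    (hd : ∀ l, DifferentiableWithinAt 𝕜 (P l) S t) (k l : ι) :
    derivWithin (P k) S t * P l t + P k t * derivWithin (P l) S t =
      if k = l then derivWithin (P l) S t else 0 := by
  have hmul : EqOn (P k * P l) (if k = l then P l else 0) S := fun s hs => by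
    rcases eq_or_ne k l with rfl | hkl
    · simpa using ((hP s hs).idem k).eq
    · simpa [hkl] using (hP s hs).ortho hkl
  rw [← derivWithin_mul (hd k) (hd l), derivWithin_congr hmul (hmul ht)]
  split_ifs <;> simp

theorem hasDerivWithinAt_schurMul_of_parallel [Fintype ι] {c : ι → ι → 𝕜 → 𝕜} {c' : ι → ι → 𝕜}
    {X : 𝕜 → 𝔸} {X' K : 𝔸} (hc : ∀ k l, HasDerivWithinAt (c k l) (c' k l) S t)
    (hP : ∀ l, HasDerivWithinAt (P l) ⁅K, P l t⁆ S t) (hX : HasDerivWithinAt X X' S t) :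
    HasDerivWithinAt (fun s => schurMul (fun k l => c k l s) (fun l => P l s) (X s))
      (schurMul c' (fun l => P l t) (X t) +
        schurMul (fun k l => c k l t) (fun l => P l t) (X' - ⁅K, X t⁆) +
        ⁅K, schurMul (fun k l => c k l t) (fun l => P l t) (X t)⁆) S t := by
  refine (HasDerivWithinAt.fun_sum fun k _ => HasDerivWithinAt.fun_sum fun l _ =>
    (hc k l).smul (((hP k).mul hX).mul (hP l))).congr_deriv ?_
  simp only [schurMul, Ring.lie_def, Finset.mul_sum, Finset.sum_mul, ← Finset.sum_sub_distrib,
    ← Finset.sum_add_distrib]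
  refine Finset.sum_congr rfl fun k _ => Finset.sum_congr rfl fun l _ => ?_
  simp only [Pi.mul_apply, mul_smul_comm, smul_mul_assoc, ← smul_sub]
  rw [add_comm (c k l t • _), add_assoc, ← smul_add]
  congr 2
  noncomm_ring

theorem hasDerivWithinAt_inv_sub {E : ι → 𝕜 → 𝕜} {E' : ι → 𝕜}
    (hE : ∀ l, HasDerivWithinAt (E l) (E' l) S t) (hinj : Function.Injective fun l => E l t)
    (k l : ι) :
    HasDerivWithinAt (fun s => (E k s - E l s)⁻¹)
      (-(E' k - E' l) * ((E k t - E l t)⁻¹) ^ 2) S t := by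
  rcases eq_or_ne k l with rfl | hkl
  · simpa using hasDerivWithinAt_const t S (0 : 𝕜)
  · refine (((hE k).sub (hE l)).fun_inv (sub_ne_zero.2 (hinj.ne hkl))).congr_deriv ?_
    rw [inv_pow, div_eq_mul_inv]
    rfl

end ParallelTransport

section Intertwining

theorem smul_add_mul_one_sub_sub_one_sub_mul_smul {𝕜 R : Type*} [Field 𝕜] [Ring R] [Algebra 𝕜 R]
    {κ : 𝕜} (hκ : κ ≠ 0) {a f h : R} (hcomm : ⁅h, f⁆ = a) :
    (κ • h + a) * (1 - κ⁻¹ • f) - (1 - κ⁻¹ • f) * κ • h = -(κ⁻¹ • (a * f)) := by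
  have hhf : h * f = a + f * h := sub_eq_iff_eq_add.1 hcomm
  simp only [add_mul, mul_sub, sub_mul, mul_one, one_mul, smul_mul_assoc, mul_smul_comm, hhf,
    smul_add, smul_sub, smul_inv_smul₀ hκ, inv_smul_smul₀ hκ]
  abel

theorem norm_sub_le_of_norm_one_sub_mul_sub_mul_one_sub_le {R : Type*} [NormedRing R] [StarRing R]
    [CStarRing R] {u v x y : R} {f r : ℝ} (hu : u ∈ unitary R) (hv : v ∈ unitary R)
    (hr : ‖(1 - x) * u - v * (1 - y)‖ ≤ r) (hx : ‖x‖ ≤ f) (hy : ‖y‖ ≤ f) :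
    ‖u - v‖ ≤ r + 2 * f := by
  have hxu : ‖x * u‖ ≤ f := (CStarRing.norm_mul_mem_unitary x hu).trans_le hx
  have hvy : ‖v * y‖ ≤ f := (CStarRing.norm_mem_unitary_mul y hv).trans_le hy
  calc ‖u - v‖ = ‖((1 - x) * u - v * (1 - y)) + (x * u - v * y)‖ := by
        congr 1
        noncomm_ring
    _ ≤ r + (f + f) := norm_add_le_of_le hr (norm_sub_le_of_le hxu hvy)
    _ = r + 2 * f := by ring

end Intertwining

section Propagator

variable {𝓗 : Type*} [NormedAddCommGroup 𝓗] [InnerProductSpace ℂ 𝓗] {T t : ℝ}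
  {H K : ℝ → 𝓗 →L[ℂ] 𝓗}

theorem propagator_zero (H : ℝ → 𝓗 →L[ℂ] 𝓗) : propagator H 0 = 1 := by
  rw [propagator, tsum_eq_single 0]
  · rfl
  · intro n hn
    obtain ⟨k, rfl⟩ := Nat.exists_eq_succ_of_ne_zero hn
    simp [dysonTerm]

theorem norm_dysonTerm_le {M : ℝ} (hM : ∀ s ∈ Icc 0 T, ‖H s‖ ≤ M) (n : ℕ) :
    ∀ t ∈ Icc 0 T, ‖dysonTerm H n t‖ ≤ (M * t) ^ n / n.factorial := by
  induction n with
  | zero =>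
    intro t _
    rw [dysonTerm, pow_zero, Nat.factorial_zero, Nat.cast_one, div_one]
    exact ContinuousLinearMap.norm_id_le
  | succ n ih =>
    intro t ht
    have hintegrand : ∀ s ∈ Ioc 0 t,
        ‖H s * dysonTerm H n s‖ ≤ M ^ (n + 1) / n.factorial * s ^ n := by
      intro s hs
      have hsT : s ∈ Icc 0 T := ⟨hs.1.le, hs.2.trans ht.2⟩
      calc ‖H s * dysonTerm H n s‖ ≤ M * ((M * s) ^ n / n.factorial) :=
            norm_mul_le_of_le (hM s hsT) (ih s hsT)
        _ = M ^ (n + 1) / n.factorial * s ^ n := by ring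
    calc ‖dysonTerm H (n + 1) t‖ = ‖∫ s in (0 : ℝ)..t, H s * dysonTerm H n s‖ := by
          rw [dysonTerm, norm_smul, norm_neg, Complex.norm_I, one_mul]
      _ ≤ ∫ s in (0 : ℝ)..t, M ^ (n + 1) / n.factorial * s ^ n :=
          intervalIntegral.norm_integral_le_of_norm_le ht.1 (.of_forall hintegrand)
            ((continuous_const.mul (continuous_pow n)).intervalIntegrable _ _)
      _ = (M * t) ^ (n + 1) / (n + 1).factorial := by
          rw [intervalIntegral.integral_const_mul, integral_pow, Nat.factorial_succ, mul_pow,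
            zero_pow n.succ_ne_zero, sub_zero]
          push_cast
          field_simp

theorem exists_summable_norm_dysonTerm_le (hH : ContinuousOn H (Icc 0 T)) :
    ∃ u : ℕ → ℝ, Summable u ∧ ∀ n, ∀ t ∈ Icc 0 T, ‖dysonTerm H n t‖ ≤ u n := by
  obtain ⟨M, hM⟩ := isCompact_Icc.exists_bound_of_continuousOn hH
  refine ⟨_, Real.summable_pow_div_factorial (M * T), fun n t ht => ?_⟩
  have hM0 : 0 ≤ M := (norm_nonneg _).trans (hM t ht)
  have ht0 : 0 ≤ t := ht.1
  refine (norm_dysonTerm_le hM n t ht).trans ?_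
  gcongr
  exact ht.2

variable [CompleteSpace 𝓗]

theorem continuousOn_dysonTerm (hH : ContinuousOn H (Icc 0 T)) (n : ℕ) :
    ContinuousOn (dysonTerm H n) (Icc 0 T) := by
  induction n with
  | zero => exact continuousOn_const
  | succ n ih =>
    exact ContinuousOn.const_smul (fun t ht =>
      (hasDerivWithinAt_integral_Icc (hH.mul ih) ht).continuousWithinAt) (-Complex.I)

theorem continuousOn_propagator (hH : ContinuousOn H (Icc 0 T)) :
    ContinuousOn (propagator H) (Icc 0 T) := by
  obtain ⟨u, hu, hbound⟩ := exists_summable_norm_dysonTerm_le hH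
  exact continuousOn_tsum (continuousOn_dysonTerm hH) hu hbound

theorem propagator_eq_integral (hH : ContinuousOn H (Icc 0 T)) (ht : t ∈ Icc 0 T) :
    propagator H t = 1 + (-Complex.I) • ∫ s in (0 : ℝ)..t, H s * propagator H s := by
  obtain ⟨u, hu, hbound⟩ := exists_summable_norm_dysonTerm_le hH
  obtain ⟨M, hM⟩ := isCompact_Icc.exists_bound_of_continuousOn hH
  have hsub : uIoc 0 t ⊆ Icc 0 T := by
    rw [uIoc_of_le ht.1]
    exact Ioc_subset_Icc_self.trans (Icc_subset_Icc_right ht.2)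
  have hsummable : ∀ s ∈ Icc 0 T, Summable fun n => dysonTerm H n s := fun s hs =>
    hu.of_norm_bounded fun n => hbound n s hs
  have hintegral : HasSum (fun n => ∫ s in (0 : ℝ)..t, H s * dysonTerm H n s)
      (∫ s in (0 : ℝ)..t, H s * propagator H s) := by
    refine intervalIntegral.hasSum_integral_of_dominated_convergence (fun n _ => M * u n)
      (fun n => ?_) (fun n => .of_forall fun s hs => ?_) (.of_forall fun s _ => hu.mul_left M)
      intervalIntegrable_const (.of_forall fun s hs => ?_)
    · exact ((hH.mul (continuousOn_dysonTerm hH n)).mono hsub).aestronglyMeasurable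
        measurableSet_uIoc
    · exact norm_mul_le_of_le (hM s (hsub hs)) (hbound n s (hsub hs))
    · exact (hsummable s (hsub hs)).hasSum.mul_left (H s)
  rw [propagator, (hsummable t ht).tsum_eq_zero_add]
  congr 1
  exact (hintegral.const_smul (-Complex.I)).tsum_eq

theorem hasDerivWithinAt_propagator (hH : ContinuousOn H (Icc 0 T)) (ht : t ∈ Icc 0 T) :
    HasDerivWithinAt (propagator H) ((-Complex.I) • (H t * propagator H t)) (Icc 0 T) t :=
  (((hasDerivWithinAt_integral_Icc (hH.mul (continuousOn_propagator hH)) ht).const_smul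
    (-Complex.I)).const_add 1).congr_of_mem (fun _ => propagator_eq_integral hH) ht

theorem hasDerivWithinAt_star_propagator (hH : ContinuousOn H (Icc 0 T))
    (ht : t ∈ Icc 0 T) (hadj : IsSelfAdjoint (H t)) :
    HasDerivWithinAt (fun s => star (propagator H s))
      (Complex.I • (star (propagator H t) * H t)) (Icc 0 T) t :=
  (hasDerivWithinAt_propagator hH ht).star.congr_deriv <| by
    simp [star_smul, star_mul, hadj.star_eq]

theorem hasDerivWithinAt_star_propagator_mul_mul_propagator {G : ℝ → 𝓗 →L[ℂ] 𝓗}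
    {G' : 𝓗 →L[ℂ] 𝓗} (hH : ContinuousOn H (Icc 0 T)) (hK : ContinuousOn K (Icc 0 T))
    (ht : t ∈ Icc 0 T) (hKadj : IsSelfAdjoint (K t)) (hG : HasDerivWithinAt G G' (Icc 0 T) t) :
    HasDerivWithinAt (fun s => star (propagator K s) * (G s * propagator H s))
      (star (propagator K t) * ((G' + Complex.I • (K t * G t - G t * H t)) * propagator H t))
      (Icc 0 T) t := by
  refine ((hasDerivWithinAt_star_propagator hK ht hKadj).mul
    (hG.mul (hasDerivWithinAt_propagator hH ht))).congr_deriv ?_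
  simp only [smul_mul_assoc, mul_smul_comm, add_mul, mul_add, sub_mul, mul_sub, smul_sub, mul_assoc,
    neg_smul, mul_neg, Pi.mul_apply]
  abel

theorem propagator_mem_unitary (hH : ContinuousOn H (Icc 0 T))
    (hadj : ∀ s ∈ Icc 0 T, IsSelfAdjoint (H s)) (ht : t ∈ Icc 0 T) :
    propagator H t ∈ unitary (𝓗 →L[ℂ] 𝓗) := by
  refine Unitary.mem_iff.2 ⟨?_, ?_⟩
  · have hconst : ∀ s ∈ Icc 0 T,
        HasDerivWithinAt (fun u => star (propagator H u) * propagator H u) 0 (Icc 0 T) s := by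
      intro s hs
      simpa using hasDerivWithinAt_star_propagator_mul_mul_propagator hH hH hs (hadj s hs)
        (hasDerivWithinAt_const s (Icc 0 T) (1 : 𝓗 →L[ℂ] 𝓗))
    have h := norm_image_sub_le_of_norm_deriv_le_segment' hconst (C := 0) (by simp) t ht
    simpa [propagator_zero, sub_eq_zero] using h
  · -- In infinite dimensions `U† U = 1` does not give `U U† = 1`, but `U U† - 1` solves a linear
    -- homogeneous equation.
    have hlie : ∀ s ∈ Icc 0 T,
        HasDerivWithinAt (fun u => propagator H u * star (propagator H u) - 1)
          ⁅(-Complex.I) • H s, propagator H s * star (propagator H s) - 1⁆ (Icc 0 T) s := by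
      intro s hs
      refine (((hasDerivWithinAt_propagator hH hs).mul
        (hasDerivWithinAt_star_propagator hH hs (hadj s hs))).sub_const 1).congr_deriv ?_
      simp only [Ring.lie_def, smul_mul_assoc, mul_smul_comm, neg_smul, smul_sub, sub_mul, mul_sub,
        neg_mul, mul_neg, one_mul, mul_one, mul_assoc]
      abel
    exact sub_eq_zero.1 (eq_zero_of_hasDerivWithinAt_lie (hH.const_smul (-Complex.I)) hlie
      (by simp [propagator_zero]) t ht)

theorem norm_mul_propagator_sub_propagator_mul_le {G G' : ℝ → 𝓗 →L[ℂ] 𝓗} {r : ℝ}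
    (hH : ContinuousOn H (Icc 0 T)) (hHadj : ∀ s ∈ Icc 0 T, IsSelfAdjoint (H s))
    (hK : ContinuousOn K (Icc 0 T)) (hKadj : ∀ s ∈ Icc 0 T, IsSelfAdjoint (K s))
    (hG : ∀ s ∈ Icc 0 T, HasDerivWithinAt G (G' s) (Icc 0 T) s)
    (hr : ∀ s ∈ Icc 0 T, ‖G' s + Complex.I • (K s * G s - G s * H s)‖ ≤ r) (ht : t ∈ Icc 0 T) :
    ‖G t * propagator H t - propagator K t * G 0‖ ≤ r * t := by
  have hU : ∀ s ∈ Icc 0 T, propagator H s ∈ unitary (𝓗 →L[ℂ] 𝓗) := fun s =>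
    propagator_mem_unitary hH hHadj
  have hV : ∀ s ∈ Icc 0 T, propagator K s ∈ unitary (𝓗 →L[ℂ] 𝓗) := fun s =>
    propagator_mem_unitary hK hKadj
  have hmvt := norm_image_sub_le_of_norm_deriv_le_segment'
    (fun s hs => hasDerivWithinAt_star_propagator_mul_mul_propagator hH hK hs (hKadj s hs)
      (hG s hs))
    (C := r) (fun s hs => by
      have hs' := Ico_subset_Icc_self hs
      rw [CStarRing.norm_mem_unitary_mul _ (Unitary.star_mem (hV s hs')),
        CStarRing.norm_mul_mem_unitary _ (hU s hs')]
      exact hr s hs') t ht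
  calc ‖G t * propagator H t - propagator K t * G 0‖
      = ‖star (propagator K t) * (G t * propagator H t - propagator K t * G 0)‖ :=
        (CStarRing.norm_mem_unitary_mul _ (Unitary.star_mem (hV t ht))).symm
    _ = ‖star (propagator K t) * (G t * propagator H t) - G 0‖ := by
        rw [mul_sub, ← mul_assoc _ (propagator K t), Unitary.star_mul_self_of_mem (hV t ht),
          one_mul]
    _ ≤ r * t := by simpa [propagator_zero] using hmvt

theorem norm_propagator_smul_sub_propagator_smul_add_le {A F F' : ℝ → 𝓗 →L[ℂ] 𝓗} {κ f r : ℝ}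
    (hκ : 0 < κ)
    (hH : ContinuousOn H (Icc 0 T)) (hHadj : ∀ s ∈ Icc 0 T, IsSelfAdjoint (H s))
    (hA : ContinuousOn A (Icc 0 T)) (hAadj : ∀ s ∈ Icc 0 T, IsSelfAdjoint (A s))
    (hF : ∀ s ∈ Icc 0 T, HasDerivWithinAt F (F' s) (Icc 0 T) s)
    (hcomm : ∀ s ∈ Icc 0 T, ⁅H s, F s⁆ = A s) (hf : ∀ s ∈ Icc 0 T, ‖F s‖ ≤ f)
    (hr : ∀ s ∈ Icc 0 T, ‖F' s + Complex.I • (A s * F s)‖ ≤ r) (ht : t ∈ Icc 0 T) :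
    ‖propagator (fun s => κ • H s) t - propagator (fun s => κ • H s + A s) t‖ ≤
      κ⁻¹ * (2 * f + t * r) := by
  have hκH : ContinuousOn (fun s => κ • H s) (Icc 0 T) := hH.const_smul κ
  have hκHadj : ∀ s ∈ Icc 0 T, IsSelfAdjoint (κ • H s) := fun s hs =>
    (IsSelfAdjoint.all κ).smul (hHadj s hs)
  have hκHA : ContinuousOn (fun s => κ • H s + A s) (Icc 0 T) := hκH.add hA
  have hκHAadj : ∀ s ∈ Icc 0 T, IsSelfAdjoint (κ • H s + A s) := fun s hs =>
    (hκHadj s hs).add (hAadj s hs)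
  have hnorm (x : 𝓗 →L[ℂ] 𝓗) : ‖κ⁻¹ • x‖ = κ⁻¹ * ‖x‖ := norm_smul_of_nonneg (by positivity) x
  have hdefect : ∀ s ∈ Icc 0 T, ‖-(κ⁻¹ • F' s) + Complex.I • ((κ • H s + A s) * (1 - κ⁻¹ • F s) -
      (1 - κ⁻¹ • F s) * κ • H s)‖ ≤ κ⁻¹ * r := by
    intro s hs
    rw [smul_add_mul_one_sub_sub_one_sub_mul_smul hκ.ne' (hcomm s hs), smul_neg,
      smul_comm Complex.I, ← neg_add, ← smul_add, norm_neg, hnorm]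
    gcongr
    exact hr s hs
  have hnormF : ∀ s ∈ Icc 0 T, ‖κ⁻¹ • F s‖ ≤ κ⁻¹ * f := fun s hs => by
    rw [hnorm]
    gcongr
    exact hf s hs
  have hintertwine : ‖(1 - κ⁻¹ • F t) * propagator (fun s => κ • H s) t -
      propagator (fun s => κ • H s + A s) t * (1 - κ⁻¹ • F 0)‖ ≤ κ⁻¹ * r * t :=
    norm_mul_propagator_sub_propagator_mul_le (G := fun s => 1 - κ⁻¹ • F s)
      hκH hκHadj hκHA hκHAadj (fun s hs => ((hF s hs).const_smul κ⁻¹).const_sub 1) hdefect ht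
  calc ‖propagator (fun s => κ • H s) t - propagator (fun s => κ • H s + A s) t‖
      ≤ κ⁻¹ * r * t + 2 * (κ⁻¹ * f) :=
        norm_sub_le_of_norm_one_sub_mul_sub_mul_one_sub_le
          (propagator_mem_unitary hκH hκHadj ht) (propagator_mem_unitary hκHA hκHAadj ht)
          hintertwine (hnormF t ht) (hnormF 0 (left_mem_Icc.2 (ht.1.trans ht.2)))
    _ = κ⁻¹ * (2 * f + t * r) := by ring

end Propagator

section AdiabaticEstimate

variable {𝓗 ι : Type*} [NormedAddCommGroup 𝓗] [InnerProductSpace ℂ 𝓗] [CompleteSpace 𝓗] [Fintype ι]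
  {T t : ℝ} {H A A' : ℝ → 𝓗 →L[ℂ] 𝓗} {E E' : ι → ℝ → ℝ} {P : ι → ℝ → 𝓗 →L[ℂ] 𝓗}

theorem norm_propagator_sub_propagator_add_le_of_parallel {κ g η' a b : ℝ} (hκ : 0 < κ)
    (hg0 : 0 ≤ g) (hη'0 : 0 ≤ η')
    (hH : ∀ s ∈ Icc 0 T, H s = ∑ l, E l s • P l s)
    (hP : ∀ s ∈ Icc 0 T, CompleteOrthogonalIdempotents fun l => P l s)
    (hPadj : ∀ s ∈ Icc 0 T, ∀ l, IsSelfAdjoint (P l s))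
    (hAadj : ∀ s ∈ Icc 0 T, IsSelfAdjoint (A s))
    (hPd : ∀ s ∈ Icc 0 T, ∀ l,
      HasDerivWithinAt (P l) ⁅(-Complex.I) • A s, P l s⁆ (Icc 0 T) s)
    (hPA : ∀ s ∈ Icc 0 T, ∀ l, P l s * A s * P l s = 0)
    (hEd : ∀ s ∈ Icc 0 T, ∀ l, HasDerivWithinAt (E l) (E' l s) (Icc 0 T) s)
    (hAd : ∀ s ∈ Icc 0 T, HasDerivWithinAt A (A' s) (Icc 0 T) s)
    (hinj : ∀ s ∈ Icc 0 T, Function.Injective fun l => E l s)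
    (hg : ∀ s ∈ Icc 0 T, ∀ k l, |(E k s - E l s)⁻¹| ≤ g)
    (hη' : ∀ s ∈ Icc 0 T, ∀ k l, |E' k s - E' l s| ≤ η')
    (ha : ∀ s ∈ Icc 0 T, ‖A s‖ ≤ a) (hb : ∀ s ∈ Icc 0 T, ‖A' s‖ ≤ b) (ht : t ∈ Icc 0 T) :
    ‖propagator (fun s => κ • H s) t - propagator (fun s => κ • H s + A s) t‖ ≤
      √(Fintype.card ι) * κ⁻¹ * g * (2 * a + t * (η' * g * a + b + a ^ 2)) := by
  have hHc : ContinuousOn H (Icc 0 T) :=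
    (continuousOn_finsetSum Finset.univ fun l _ => ContinuousOn.smul
      (fun s hs => (hEd s hs l).continuousWithinAt)
      fun s hs => (hPd s hs l).continuousWithinAt).congr hH
  have hHadj : ∀ s ∈ Icc 0 T, IsSelfAdjoint (H s) := fun s hs => by
    rw [hH s hs]
    exact isSelfAdjoint_sum _ fun l _ => (IsSelfAdjoint.all (E l s)).smul (hPadj s hs l)
  set w : ι → ι → ℝ → ℝ := fun k l s => (E k s - E l s)⁻¹
  have hw' : ∀ s ∈ Icc 0 T, ∀ k l, |-(E' k s - E' l s) * w k l s ^ 2| ≤ η' * g ^ 2 :=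
    fun s hs k l => by
      rw [abs_mul, abs_neg, abs_pow]
      gcongr
      exacts [hη' s hs k l, hg s hs k l]
  have hcomm : ∀ s ∈ Icc 0 T,
      ⁅H s, schurMul (fun k l => w k l s) (fun l => P l s) (A s)⁆ = A s := fun s hs => by
    rw [hH s hs]
    exact lie_schurMul_inv_sub (hP s hs) (hinj s hs) (hPA s hs)
  have hF : ∀ s ∈ Icc 0 T,
      ‖schurMul (fun k l => w k l s) (fun l => P l s) (A s)‖ ≤ √(Fintype.card ι) * g * a :=
    fun s hs => (norm_schurMul_le (hP s hs) (hPadj s hs) hg0 (hg s hs) _).trans <| by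
      gcongr
      exact ha s hs
  refine (norm_propagator_smul_sub_propagator_smul_add_le hκ hHc hHadj
    (fun s hs => (hAd s hs).continuousWithinAt) hAadj
    (fun s hs => hasDerivWithinAt_schurMul_of_parallel
      (hasDerivWithinAt_inv_sub (hEd s hs) (hinj s hs)) (hPd s hs) (hAd s hs))
    hcomm hF
    (fun s hs => norm_schurMul_deriv_add_le (hP s hs) (hPadj s hs) hg0
      (by positivity) (hg s hs) (hw' s hs) (ha s hs) (hb s hs)) ht).trans_eq ?_
  ring

end AdiabaticEstimate

section SpectralGap

variable {m : ℕ} {T t : ℝ} {E : Fin m → ℝ → ℝ} {k l : Fin m}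

theorem isCompact_setOf_exists_ne {X Y ι : Type*} [TopologicalSpace X] [TopologicalSpace Y]
    [Finite ι] {f : ι → ι → X → Y} {s : Set X} (hs : IsCompact s)
    (hf : ∀ k l, ContinuousOn (f k l) s) :
    IsCompact {y | ∃ k l, k ≠ l ∧ ∃ x ∈ s, y = f k l x} := by
  have h : {y | ∃ k l, k ≠ l ∧ ∃ x ∈ s, y = f k l x} = ⋃ k, ⋃ l, ⋃ _ : k ≠ l, f k l '' s := by
    ext y
    simp [eq_comm]
  rw [h]
  exact isCompact_iUnion fun k => isCompact_iUnion fun l => isCompact_iUnion fun _ =>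
    hs.image_of_continuousOn (hf k l)

theorem isCompact_gaps (hE : ∀ l, ContinuousOn (E l) (Icc 0 T)) :
    IsCompact {x | ∃ k l : Fin m, k ≠ l ∧ ∃ t ∈ Icc 0 T, x = |E k t - E l t|} :=
  isCompact_setOf_exists_ne isCompact_Icc fun k l => ((hE k).sub (hE l)).abs

theorem minGap_le (hE : ∀ l, ContinuousOn (E l) (Icc 0 T)) (hkl : k ≠ l) (ht : t ∈ Icc 0 T) :
    minGap T E ≤ |E k t - E l t| :=
  csInf_le (isCompact_gaps hE).bddBelow ⟨k, l, hkl, t, ht, rfl⟩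

theorem minGap_nonneg : 0 ≤ minGap T E := by
  refine Real.sInf_nonneg ?_
  rintro _ ⟨k, l, -, t, -, rfl⟩
  exact abs_nonneg _

theorem minGap_pos (hE : ∀ l, ContinuousOn (E l) (Icc 0 T))
    (hinj : ∀ s ∈ Icc 0 T, Function.Injective fun l => E l s) (hkl : k ≠ l) (ht : t ∈ Icc 0 T) :
    0 < minGap T E := by
  obtain ⟨k', l', hkl', s, hs, h⟩ :=
    (isCompact_gaps hE).sInf_mem ⟨_, k, l, hkl, t, ht, rfl⟩
  exact (abs_pos.2 (sub_ne_zero.2 ((hinj s hs).ne hkl'))).trans_eq h.symm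

theorem abs_inv_sub_le_inv_minGap (hE : ∀ l, ContinuousOn (E l) (Icc 0 T))
    (hinj : ∀ s ∈ Icc 0 T, Function.Injective fun l => E l s) (ht : t ∈ Icc 0 T) (k l : Fin m) :
    |(E k t - E l t)⁻¹| ≤ (minGap T E)⁻¹ := by
  rcases eq_or_ne k l with rfl | hkl
  · simpa using minGap_nonneg
  · rw [abs_inv]
    exact inv_anti₀ (minGap_pos hE hinj hkl ht) (minGap_le hE hkl ht)

theorem maxSlope_nonneg : 0 ≤ maxSlope T E := by
  refine Real.sSup_nonneg ?_
  rintro _ ⟨k, l, -, t, -, rfl⟩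
  exact abs_nonneg _

theorem abs_derivWithin_sub_derivWithin_le_maxSlope (hT : 0 < T)
    (hE : ∀ l, ContDiffOn ℝ 1 (E l) (Icc 0 T)) (ht : t ∈ Icc 0 T) (k l : Fin m) :
    |derivWithin (E k) (Icc 0 T) t - derivWithin (E l) (Icc 0 T) t| ≤ maxSlope T E := by
  rcases eq_or_ne k l with rfl | hkl
  · simpa using maxSlope_nonneg
  have hdiff (l : Fin m) := (hE l).differentiableOn one_ne_zero t ht
  have hcompact := isCompact_setOf_exists_ne isCompact_Icc fun k l =>
    (((hE k).sub (hE l)).continuousOn_derivWithin (uniqueDiffOn_Icc hT) le_rfl).abs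
  rw [← derivWithin_fun_sub (hdiff k) (hdiff l)]
  exact le_csSup hcompact.bddAbove ⟨k, l, hkl, t, ht, rfl⟩

end SpectralGap

section Connection

variable {𝓗 : Type*} [NormedAddCommGroup 𝓗] [InnerProductSpace ℂ 𝓗] {m : ℕ} {T t : ℝ}
  {P : Fin m → ℝ → 𝓗 →L[ℂ] 𝓗}

theorem supNorm_nonneg (A : ℝ → 𝓗 →L[ℂ] 𝓗) : 0 ≤ supNorm T A := by
  refine Real.sSup_nonneg ?_
  rintro _ ⟨t, -, rfl⟩
  exact norm_nonneg _

theorem norm_le_supNorm {A : ℝ → 𝓗 →L[ℂ] 𝓗} (hA : ContinuousOn A (Icc 0 T)) (ht : t ∈ Icc 0 T) :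
    ‖A t‖ ≤ supNorm T A :=
  le_csSup (isCompact_Icc.image_of_continuousOn hA.norm).bddAbove ⟨t, ht, rfl⟩

theorem contDiffOn_connection (hT : 0 < T) (hP : ∀ l, ContDiffOn ℝ 2 (P l) (Icc 0 T)) :
    ContDiffOn ℝ 1 (connection T P) (Icc 0 T) := by
  have hP' : ∀ l, ContDiffOn ℝ 1 (derivWithin (P l) (Icc 0 T)) (Icc 0 T) := fun l =>
    (hP l).derivWithin (uniqueDiffOn_Icc hT) (by norm_num)
  have hP₁ : ∀ l, ContDiffOn ℝ 1 (P l) (Icc 0 T) := fun l => (hP l).of_le (by norm_num)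
  exact ContDiffOn.sum fun l _ =>
    (((hP' l).mul (hP₁ l)).sub ((hP₁ l).mul (hP' l))).const_smul (Complex.I / 2)

theorem isSelfAdjoint_connection [CompleteSpace 𝓗]
    (hadj : ∀ s ∈ Icc 0 T, ∀ l, IsSelfAdjoint (P l s)) (ht : t ∈ Icc 0 T) :
    IsSelfAdjoint (connection T P t) := by
  have hstar (l : Fin m) :
      star (derivWithin (P l) (Icc 0 T) t) = derivWithin (P l) (Icc 0 T) t := by
    rw [← derivWithin.star]
    exact derivWithin_congr (fun s hs => (hadj s hs l).star_eq) (hadj t ht l).star_eq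
  have hI : star (Complex.I / 2) = -(Complex.I / 2) := by simp [neg_div]
  simp only [IsSelfAdjoint, connection, star_sum, star_smul, star_sub, star_mul, hstar,
    (hadj t ht _).star_eq, hI, neg_smul, ← smul_neg, neg_sub]

theorem connection_eq_smul_sum
    (hP : ∀ s ∈ Icc 0 T, CompleteOrthogonalIdempotents fun l => P l s)
    (hd : ∀ l, DifferentiableOn ℝ (P l) (Icc 0 T)) (ht : t ∈ Icc 0 T) :
    connection T P t = Complex.I • ∑ l, derivWithin (P l) (Icc 0 T) t * P l t := by
  have hleibniz := derivWithin_leibniz_of_orthogonalIdempotents ht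
    (fun s hs => (hP s hs).toOrthogonalIdempotents) fun l => hd l t ht
  rw [connection, ← Finset.smul_sum, sum_commutator_of_leibniz (hP t ht) hleibniz, two_mul,
    ← two_smul ℂ, smul_smul, div_mul_cancel₀ _ two_ne_zero]

theorem hasDerivWithinAt_lie_connection
    (hP : ∀ s ∈ Icc 0 T, CompleteOrthogonalIdempotents fun l => P l s)
    (hd : ∀ l, DifferentiableOn ℝ (P l) (Icc 0 T)) (ht : t ∈ Icc 0 T) (l : Fin m) :
    HasDerivWithinAt (P l) ⁅(-Complex.I) • connection T P t, P l t⁆ (Icc 0 T) t := by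
  have hleibniz := derivWithin_leibniz_of_orthogonalIdempotents ht
    (fun s hs => (hP s hs).toOrthogonalIdempotents) fun l => hd l t ht
  refine (hd l t ht).hasDerivWithinAt.congr_deriv ?_
  rw [connection_eq_smul_sum hP hd ht, smul_smul, neg_mul, Complex.I_mul_I, neg_neg, one_smul,
    lie_sum_mul_of_leibniz (hP t ht) hleibniz]

theorem mul_connection_mul_self
    (hP : ∀ s ∈ Icc 0 T, CompleteOrthogonalIdempotents fun l => P l s)
    (hd : ∀ l, DifferentiableOn ℝ (P l) (Icc 0 T)) (ht : t ∈ Icc 0 T) (l : Fin m) :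
    P l t * connection T P t * P l t = 0 := by
  have hleibniz := derivWithin_leibniz_of_orthogonalIdempotents ht
    (fun s hs => (hP s hs).toOrthogonalIdempotents) fun l => hd l t ht
  rw [connection_eq_smul_sum hP hd ht, mul_smul_comm, smul_mul_assoc,
    mul_sum_mul_mul_self_of_leibniz (hP t ht) hleibniz, smul_zero]

end Connection

theorem mul_add_mul_add_sq_le_mul_one_add_mul {a b c q t T : ℝ} (hc : 0 ≤ c) (hq : 0 ≤ q)
    (ha : 0 ≤ a) (hb : 0 ≤ b) (ht : t ∈ Icc 0 T) :
    c * ((2 + q * t) * a + t * (b + a ^ 2)) ≤ c * (1 + T * a) * ((2 + q * T) * a + T * b) := by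
  obtain ⟨ht0, htT⟩ := ht
  have hT : 0 ≤ T := ht0.trans htT
  rw [mul_assoc]
  gcongr
  calc (2 + q * t) * a + t * (b + a ^ 2) ≤ (2 + q * T) * a + T * (b + a ^ 2) := by gcongr
    _ ≤ (2 + q * T) * a + T * (b + a ^ 2) + T * a * (a + q * T * a + T * b) :=
        le_add_of_nonneg_right (by positivity)
    _ = (1 + T * a) * ((2 + q * T) * a + T * b) := by ring

end Adiabatic

open Adiabatic

theorem mainTheorem5_general
    {𝓗 : Type*} [NormedAddCommGroup 𝓗] [InnerProductSpace ℂ 𝓗] [CompleteSpace 𝓗]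
    {m : ℕ} {T t : ℝ} (H₀ : ℝ → 𝓗 →L[ℂ] 𝓗) (E : Fin m → ℝ → ℝ) (P : Fin m → ℝ → 𝓗 →L[ℂ] 𝓗)
    (hH₀ : ∀ t ∈ Icc 0 T, H₀ t = ∑ l, E l t • P l t)
    (hPadj : ∀ t ∈ Icc 0 T, ∀ l, IsSelfAdjoint (P l t))
    (hPmul : ∀ t ∈ Icc 0 T, ∀ k l, P k t * P l t = if k = l then P l t else 0)
    (hPsum : ∀ t ∈ Icc 0 T, ∑ l, P l t = 1)
    (hE : ∀ l, ContDiffOn ℝ 1 (E l) (Icc 0 T)) (hP : ∀ l, ContDiffOn ℝ 2 (P l) (Icc 0 T))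
    (hgap : ∀ t ∈ Icc 0 T, ∀ k l, k ≠ l → 0 < |E k t - E l t|)
    {κ : ℝ} (hκ : 0 < κ) (ht : t ∈ Icc 0 T) :
    ‖propagator (fun s => κ • H₀ s) t - propagator (fun s => κ • H₀ s + connection T P s) t‖ ≤
      √m / (κ * minGap T E) * ((2 + maxSlope T E / minGap T E * t) * supNorm T (connection T P) +
        t * (supNorm T (derivWithin (connection T P) (Icc 0 T)) +
          supNorm T (connection T P) ^ 2)) := by
  have hgap0 : 0 ≤ minGap T E := minGap_nonneg
  rcases (ht.1.trans ht.2).eq_or_lt with rfl | hT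
  · obtain rfl : t = 0 := le_antisymm ht.2 ht.1
    have hA0 := supNorm_nonneg (T := 0) (connection 0 P)
    simp only [propagator_zero, sub_self, norm_zero, mul_zero, zero_mul, add_zero]
    positivity
  have hPidem (s : ℝ) (hs : s ∈ Icc 0 T) : CompleteOrthogonalIdempotents fun l => P l s :=
    ⟨OrthogonalIdempotents.iff_mul_eq.2 fun k l =>
      (hPmul s hs k l).trans (by split_ifs <;> simp_all), hPsum s hs⟩
  have hinj (s : ℝ) (hs : s ∈ Icc 0 T) : Function.Injective fun l => E l s := fun k l hkl =>
    by_contra fun hne => (hgap s hs k l hne).ne' (abs_eq_zero.2 (sub_eq_zero.2 hkl))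
  have hPd (l : Fin m) : DifferentiableOn ℝ (P l) (Icc 0 T) := (hP l).differentiableOn two_ne_zero
  have hA := contDiffOn_connection hT hP
  refine (norm_propagator_sub_propagator_add_le_of_parallel hκ (inv_nonneg.2 hgap0) maxSlope_nonneg
    hH₀ hPidem hPadj
    (fun s => isSelfAdjoint_connection hPadj)
    (fun s => hasDerivWithinAt_lie_connection hPidem hPd)
    (fun s => mul_connection_mul_self hPidem hPd)
    (fun s hs l => ((hE l).differentiableOn one_ne_zero s hs).hasDerivWithinAt)
    (fun s hs => (hA.differentiableOn one_ne_zero s hs).hasDerivWithinAt) hinj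
    (fun s => abs_inv_sub_le_inv_minGap (fun l => (hE l).continuousOn) hinj)
    (fun s => abs_derivWithin_sub_derivWithin_le_maxSlope hT hE)
    (fun s => norm_le_supNorm hA.continuousOn)
    (fun s => norm_le_supNorm (hA.continuousOn_derivWithin (uniqueDiffOn_Icc hT) le_rfl))
    ht).trans_eq ?_
  rw [Fintype.card_fin, div_eq_mul_inv, div_eq_mul_inv, mul_inv]
  ring

theorem mainTheorem5
    {𝓗 : Type*} [NormedAddCommGroup 𝓗] [InnerProductSpace ℂ 𝓗] [CompleteSpace 𝓗]
    {m : ℕ} {T : ℝ} (hT : 0 ≤ T)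
    (H₀ : ℝ → 𝓗 →L[ℂ] 𝓗) (E : Fin m → ℝ → ℝ) (P : Fin m → ℝ → 𝓗 →L[ℂ] 𝓗)
    (hH₀ : ∀ t ∈ Set.Icc 0 T, H₀ t = ∑ l, E l t • P l t)
    (hPadj : ∀ t ∈ Set.Icc 0 T, ∀ l, IsSelfAdjoint (P l t))
    (hPmul : ∀ t ∈ Set.Icc 0 T, ∀ k l, P k t * P l t = if k = l then P l t else 0)
    (hPsum : ∀ t ∈ Set.Icc 0 T, ∑ l, P l t = 1)
    (hE : ∀ l, ContDiffOn ℝ 1 (E l) (Set.Icc 0 T))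
    (hP : ∀ l, ContDiffOn ℝ 2 (P l) (Set.Icc 0 T))
    (hgap : ∀ t ∈ Set.Icc 0 T, ∀ k l, k ≠ l → 0 < |E k t - E l t|)
    {κ : ℝ} (hκ : 0 < κ) :
    ∀ t ∈ Set.Icc 0 T,
      ‖Adiabatic.propagator (fun s => κ • H₀ s) t -
          Adiabatic.propagator (fun s => κ • H₀ s + Adiabatic.connection T P s) t‖ ≤
        √(m : ℝ) / (κ * Adiabatic.minGap T E) *
          (1 + T * Adiabatic.supNorm T (Adiabatic.connection T P)) *
          ((2 + Adiabatic.maxSlope T E / Adiabatic.minGap T E * T) *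
              Adiabatic.supNorm T (Adiabatic.connection T P) +
            T * Adiabatic.supNorm T
              (derivWithin (Adiabatic.connection T P) (Set.Icc 0 T))) := by
  exact fun t ht => (mainTheorem5_general H₀ E P hH₀ hPadj hPmul hPsum hE hP hgap hκ ht).trans
    (mul_add_mul_add_sq_le_mul_one_add_mul
      (div_nonneg (Real.sqrt_nonneg _) (mul_nonneg hκ.le minGap_nonneg))
      (div_nonneg maxSlope_nonneg minGap_nonneg) (supNorm_nonneg _) (supNorm_nonneg _) ht)
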